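/- For a Banach space $Y$ (over $\mathbb{R}$ or $\mathbb{C}$) and a vector $y\in Y$ with $\|y\|=1$, let $S_y=\{y^*\in Y^*:\|y^*\|=1=y^*(y)\}$ be its state space. A unit vector $y$ is a smooth point if $S_y$ is a singleton; it is a very smooth point if, in addition, its canonical image in $Y^{**}$ is a smooth point of $Y^{**}$. The space $Y$ is Hahn–Banach smooth if, for all $y^*\in Y^*\subseteq Y^{***}$ and all $y^\perp\in Y^{***}$ vanishing on the canonical image of $Y$ in $Y^{**}$, the equalities $\|y^*+y^\perp\|=\|y^*\|=1$ imply $y^\perp=0$. Let $(\Omega,\Sigma,\mu)$ be a non-atomic probability space, let $X$ be a separable Hahn–Banach smooth Banach space, and let $f\in L^1(\mu,X)$ (the space of Bochner integrable functions) satisfy $\|f\|=1$. Suppose that the state space $S_f\subseteq L^1(\mu,X)^*$ is compact in the weak topology of $L^1(\mu,X)^*$. Then for $\mu$-almost every $\omega\in\Omega$ one has $f(\omega)\neq 0$, and $f(\omega)/\|f(\omega)\|$ is a very smooth point of the unit sphere of $X$. -/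

import Mathlib

open MeasureTheory

/-- A measure is non-atomic if every measurable set of positive measure has a measurable
subset of strictly smaller positive measure. -/
def IsNonatomicMeasure {Ω : Type*} [MeasurableSpace Ω] (μ : Measure Ω) : Prop :=
  ∀ A : Set Ω, MeasurableSet A → 0 < μ A →
    ∃ B : Set Ω, B ⊆ A ∧ MeasurableSet B ∧ 0 < μ B ∧ μ B < μ A

section BanachGeometry

variable (𝕜 : Type*) [RCLike 𝕜] {Y : Type*} [NormedAddCommGroup Y] [NormedSpace 𝕜 Y]

/-- The state space of `y`: the norm-one functionals taking the value `1` at `y`. -/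
def stateSpace (y : Y) : Set (StrongDual 𝕜 Y) :=
  {φ | ‖φ‖ = 1 ∧ φ y = 1}

/-- A unit vector whose state space is a singleton. -/
def IsSmoothPoint (y : Y) : Prop :=
  ‖y‖ = 1 ∧ ∃ φ : StrongDual 𝕜 Y, stateSpace 𝕜 y = {φ}

/-- A smooth point whose canonical image in the bidual is also a smooth point. -/
def IsVerySmoothPoint (y : Y) : Prop :=
  IsSmoothPoint 𝕜 y ∧ IsSmoothPoint 𝕜 (NormedSpace.inclusionInDoubleDual 𝕜 Y y)

/-- Compactness of a subset in the weak topology of the ambient normed space. -/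
def IsWeaklyCompact (K : Set Y) : Prop :=
  IsCompact (toWeakSpace 𝕜 Y '' K)

variable (Y) in
/-- Hahn-Banach smoothness: in the third dual of `Y`, whenever `φ` is a functional in the dual,
`ψ` annihilates the canonical image of `Y` in its bidual, and `‖φ + ψ‖ = ‖φ‖ = 1`,
then `ψ = 0`. -/
def IsHahnBanachSmooth : Prop :=
  ∀ (φ : StrongDual 𝕜 Y) (ψ : StrongDual 𝕜 (StrongDual 𝕜 (StrongDual 𝕜 Y))),
    (∀ y : Y, ψ (NormedSpace.inclusionInDoubleDual 𝕜 Y y) = 0) →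
    ‖φ‖ = 1 →
    ‖NormedSpace.inclusionInDoubleDual 𝕜 (StrongDual 𝕜 Y) φ + ψ‖ = 1 →
    ψ = 0

end BanachGeometry

/-! The proof first shows that `f` itself is a smooth point
(`stateSpace_subsingleton_of_isWeaklyCompact`). Given distinct states `φ`, `θ`, non-atomicity yields
decreasing sets `C n` with measure tending to 0 on which `φ - θ` stays large relative to the norm of
a fixed `g`. Gluing `φ` on `C n` to `θ` off it gives states converging pointwise to `θ`. By weak
compactness and Mazur, some convex combination of them is norm-close to `θ`, yet it agrees with `φ`
on all late `C m`: a contradiction.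

Smoothness then passes to the values of `f`. It amounts to vanishing symmetric second difference
quotients of the norm, and in a constant direction those of the `L¹` norm are integrals of the
nonnegative pointwise ones. A countable dense set of directions suffices, by separability. Finally,
Hahn–Banach smoothness upgrades smooth to very smooth. -/

open Filter Topology

/-! ### Smooth points and second differences of the norm -/

section SmoothPoints

variable {𝕜 : Type*} [RCLike 𝕜] {Y : Type*} [NormedAddCommGroup Y] [NormedSpace 𝕜 Y]

theorem mem_stateSpace_of_one_le_re {y : Y} (hy : ‖y‖ = 1) {φ : StrongDual 𝕜 Y} (hφ : ‖φ‖ ≤ 1)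
    (h : 1 ≤ RCLike.re (φ y)) : φ ∈ stateSpace 𝕜 y := by
  have h1 : ‖φ y‖ ≤ ‖φ‖ := by simpa [hy] using φ.le_opNorm y
  have h2 := RCLike.re_le_norm (φ y)
  have h3 : (RCLike.re (φ y) : 𝕜) = φ y := RCLike.re_eq_self_of_le (by linarith)
  have h4 : RCLike.re (φ y) = 1 := by linarith
  refine ⟨by linarith, ?_⟩
  rw [← h3, h4]
  simp

/-- Functionals in the dual unit ball converge pointwise along any ultrafilter. -/
theorem exists_tendsto_apply_of_ultrafilter {ι : Type*} (U : Ultrafilter ι)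
    (φ : ι → StrongDual 𝕜 Y) (hφ : ∀ i, ‖φ i‖ ≤ 1) :
    ∃ θ : StrongDual 𝕜 Y, ‖θ‖ ≤ 1 ∧ ∀ y, Tendsto (fun i => φ i y) U (𝓝 (θ y)) := by
  have hK := WeakDual.isCompact_closedBall (0 : StrongDual 𝕜 Y) 1
  obtain ⟨θ, hθ, hlim⟩ := hK.ultrafilter_le_nhds' (U.map fun i => StrongDual.toWeakDual (φ i)) <| by
    refine Ultrafilter.mem_map.2 (Filter.univ_mem' fun i => ?_)
    simpa using hφ i
  refine ⟨WeakDual.toStrongDual θ, by simpa using hθ, fun y => ?_⟩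
  exact ((WeakDual.eval_continuous y).tendsto θ).comp hlim

/-- The norm has vanishing symmetric second difference quotients at a smooth point. -/
theorem IsSmoothPoint.exists_second_difference_lt {x : Y} (hx : IsSmoothPoint 𝕜 x) (h : Y)
    {c : ℝ} (hc : 0 < c) :
    ∃ n : ℕ, (n + 1) * (‖x + (((n + 1 : ℝ)⁻¹ : ℝ) : 𝕜) • h‖
      + ‖x - (((n + 1 : ℝ)⁻¹ : ℝ) : 𝕜) • h‖ - 2 * ‖x‖) < c := by
  by_contra! hcon
  obtain ⟨hx1, φ₀, hφ₀⟩ := hx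
  choose φ hφ hφx using fun n : ℕ => exists_dual_vector'' 𝕜 (x + (((n + 1 : ℝ)⁻¹ : ℝ) : 𝕜) • h)
  choose ψ hψ hψx using fun n : ℕ => exists_dual_vector'' 𝕜 (x - (((n + 1 : ℝ)⁻¹ : ℝ) : 𝕜) • h)
  obtain ⟨θ, hθ, hθlim⟩ := exists_tendsto_apply_of_ultrafilter (hyperfilter ℕ) φ hφ
  obtain ⟨η, hη, hηlim⟩ := exists_tendsto_apply_of_ultrafilter (hyperfilter ℕ) ψ hψ
  have hre {u : ℕ → 𝕜} {a : 𝕜} (hu : Tendsto u (hyperfilter ℕ) (𝓝 a)) :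
      Tendsto (fun n => RCLike.re (u n)) (hyperfilter ℕ) (𝓝 (RCLike.re a)) :=
    (RCLike.continuous_re.tendsto a).comp hu
  have hball {χ : StrongDual 𝕜 Y} (hχ : ‖χ‖ ≤ 1) (y : Y) : |RCLike.re (χ y)| ≤ ‖y‖ :=
    (RCLike.abs_re_le_norm _).trans ((χ.le_opNorm y).trans
      (mul_le_of_le_one_left (norm_nonneg y) hχ))
  have ht (n : ℕ) : 0 < ((n : ℝ) + 1)⁻¹ := by positivity
  have hφre (n : ℕ) : RCLike.re (φ n x) + (n + 1 : ℝ)⁻¹ * RCLike.re (φ n h)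
      = ‖x + (((n + 1 : ℝ)⁻¹ : ℝ) : 𝕜) • h‖ := by
    have := congrArg RCLike.re (hφx n)
    rwa [map_add, map_smul, map_add, smul_eq_mul, RCLike.re_ofReal_mul, RCLike.ofReal_re] at this
  have hψre (n : ℕ) : RCLike.re (ψ n x) - (n + 1 : ℝ)⁻¹ * RCLike.re (ψ n h)
      = ‖x - (((n + 1 : ℝ)⁻¹ : ℝ) : 𝕜) • h‖ := by
    have := congrArg RCLike.re (hψx n)
    rwa [map_sub, map_smul, map_sub, smul_eq_mul, RCLike.re_ofReal_mul, RCLike.ofReal_re] at this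
  have hsm (n : ℕ) : ‖(((n + 1 : ℝ)⁻¹ : ℝ) : 𝕜) • h‖ = (n + 1 : ℝ)⁻¹ * ‖h‖ := by
    rw [norm_smul, RCLike.norm_ofReal, abs_of_pos (ht n)]
  -- With step `t`, one `t * ‖h‖` bounds the drop of the norm from `x` to `x ± t h`, the other the
  -- value of the functional on `t h`.
  have hlow : Tendsto (fun n : ℕ => 1 - 2 * ((n + 1 : ℝ)⁻¹ * ‖h‖)) (hyperfilter ℕ) (𝓝 1) := by
    have h0 : Tendsto (fun n : ℕ => (n + 1 : ℝ)⁻¹) atTop (𝓝 0) := by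
      simpa using tendsto_one_div_add_atTop_nhds_zero_nat (𝕜 := ℝ)
    have h1 := ((h0.mul_const ‖h‖).const_mul 2).const_sub 1
    simp only [zero_mul, mul_zero, sub_zero] at h1
    exact h1.mono_left (Nat.hyperfilter_le_atTop)
  have hθx : 1 ≤ RCLike.re (θ x) := by
    refine le_of_tendsto_of_tendsto' hlow (hre (hθlim x)) fun n => ?_
    have h1 := norm_sub_le (x + (((n + 1 : ℝ)⁻¹ : ℝ) : 𝕜) • h) ((((n + 1 : ℝ)⁻¹ : ℝ) : 𝕜) • h)
    rw [add_sub_cancel_right, hsm, hx1] at h1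
    have h2 := mul_le_mul_of_nonneg_left (abs_le.1 (hball (hφ n) h)).2 (ht n).le
    linarith [hφre n]
  have hηx : 1 ≤ RCLike.re (η x) := by
    refine le_of_tendsto_of_tendsto' hlow (hre (hηlim x)) fun n => ?_
    have h1 := norm_add_le (x - (((n + 1 : ℝ)⁻¹ : ℝ) : 𝕜) • h) ((((n + 1 : ℝ)⁻¹ : ℝ) : 𝕜) • h)
    rw [sub_add_cancel, hsm, hx1] at h1
    have h2 := mul_le_mul_of_nonneg_left (abs_le.1 (hball (hψ n) h)).1 (ht n).le
    linarith [hψre n]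
  -- The limits are states at `x`, but the assumed lower bound on the quotients keeps them `c` apart
  -- on `h`.
  have hdiff : c ≤ RCLike.re (θ h) - RCLike.re (η h) := by
    refine ge_of_tendsto' ((hre (hθlim h)).sub (hre (hηlim h))) fun n => ?_
    have h1 := (abs_le.1 (hball (hφ n) x)).2
    have h2 := (abs_le.1 (hball (hψ n) x)).2
    refine (hcon n).trans ?_
    rw [← hφre, ← hψre]
    have h3 : ((n : ℝ) + 1) * (n + 1 : ℝ)⁻¹ = 1 := mul_inv_cancel₀ (by positivity)
    calc ((n : ℝ) + 1) * (RCLike.re (φ n x) + (n + 1 : ℝ)⁻¹ * RCLike.re (φ n h)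
          + (RCLike.re (ψ n x) - (n + 1 : ℝ)⁻¹ * RCLike.re (ψ n h)) - 2 * ‖x‖)
        = ((n : ℝ) + 1) * (RCLike.re (φ n x) + RCLike.re (ψ n x) - 2 * ‖x‖)
          + (((n : ℝ) + 1) * (n + 1 : ℝ)⁻¹) * (RCLike.re (φ n h) - RCLike.re (ψ n h)) := by ring
      _ ≤ RCLike.re (φ n h) - RCLike.re (ψ n h) := by
        rw [h3, one_mul]
        have : ((n : ℝ) + 1) * (RCLike.re (φ n x) + RCLike.re (ψ n x) - 2 * ‖x‖) ≤ 0 :=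
          mul_nonpos_of_nonneg_of_nonpos (by positivity) (by linarith)
        linarith
  have e1 : θ ∈ stateSpace 𝕜 x := mem_stateSpace_of_one_le_re hx1 hθ hθx
  have e2 : η ∈ stateSpace 𝕜 x := mem_stateSpace_of_one_le_re hx1 hη hηx
  rw [hφ₀, Set.mem_singleton_iff] at e1 e2
  rw [e1, e2, sub_self] at hdiff
  linarith

/-- Vanishing symmetric second difference quotients in a dense set of directions force norming
functionals to be unique. -/
theorem eq_of_second_difference {x : Y} {D : Set Y} (hD : Dense D)
    (hx : ∀ y ∈ D, ∀ c : ℝ, 0 < c → ∃ n : ℕ, (n + 1) * (‖x + (((n + 1 : ℝ)⁻¹ : ℝ) : 𝕜) • y‖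
      + ‖x - (((n + 1 : ℝ)⁻¹ : ℝ) : 𝕜) • y‖ - 2 * ‖x‖) < c)
    {φ ψ : StrongDual 𝕜 Y} (hφ : ‖φ‖ ≤ 1) (hψ : ‖ψ‖ ≤ 1)
    (hφx : φ x = (‖x‖ : 𝕜)) (hψx : ψ x = (‖x‖ : 𝕜)) : φ = ψ := by
  have hball {χ : StrongDual 𝕜 Y} (hχ : ‖χ‖ ≤ 1) (y : Y) : RCLike.re (χ y) ≤ ‖y‖ :=
    (RCLike.re_le_norm _).trans ((χ.le_opNorm y).trans
      (mul_le_of_le_one_left (norm_nonneg y) hχ))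
  have hle (y : Y) : RCLike.re ((φ - ψ) y) ≤ 0 := by
    have hclosed : IsClosed {y : Y | RCLike.re ((φ - ψ) y) ≤ 0} :=
      isClosed_le (RCLike.continuous_re.comp (φ - ψ).continuous) continuous_const
    refine hclosed.closure_subset_iff.2 (fun y hy => ?_) (hD y)
    refine le_of_forall_pos_le_add (α := ℝ) fun c hc => ?_
    obtain ⟨n, hn⟩ := hx y hy c hc
    have h1 := hball hφ (x + (((n + 1 : ℝ)⁻¹ : ℝ) : 𝕜) • y)
    have h2 := hball hψ (x - (((n + 1 : ℝ)⁻¹ : ℝ) : 𝕜) • y)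
    rw [map_add, map_smul, map_add, smul_eq_mul, RCLike.re_ofReal_mul, hφx, RCLike.ofReal_re] at h1
    rw [map_sub, map_smul, map_sub, smul_eq_mul, RCLike.re_ofReal_mul, hψx, RCLike.ofReal_re] at h2
    have h3 : ((n : ℝ) + 1) * (n + 1 : ℝ)⁻¹ = 1 := mul_inv_cancel₀ (by positivity)
    have h4 : (n + 1 : ℝ)⁻¹ * (RCLike.re (φ y) - RCLike.re (ψ y)) ≤
        ‖x + (((n + 1 : ℝ)⁻¹ : ℝ) : 𝕜) • y‖ + ‖x - (((n + 1 : ℝ)⁻¹ : ℝ) : 𝕜) • y‖ - 2 * ‖x‖ := by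
      linarith
    have h5 := mul_le_mul_of_nonneg_left h4 (by positivity : (0 : ℝ) ≤ n + 1)
    rw [← mul_assoc, h3, one_mul] at h5
    simp only [sub_apply, map_sub]
    linarith
  refine sub_eq_zero.1 (ContinuousLinearMap.ext fun y => ?_)
  -- Rotating `y` by the conjugate turns the value into a squared modulus, so the one-sided bound
  -- forces it to vanish.
  have h1 := hle ((starRingEnd 𝕜 ((φ - ψ) y)) • y)
  rw [map_smul, smul_eq_mul, RCLike.conj_mul, ← RCLike.ofReal_pow, RCLike.ofReal_re] at h1
  simpa using le_antisymm h1 (by positivity)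

/-- A state at the image of `y` restricts to a state at `y`, hence to `φ`. It therefore differs from
the canonical image of `φ` by an annihilator of `Y`, which Hahn–Banach smoothness kills. -/
theorem IsHahnBanachSmooth.isVerySmoothPoint (hY : IsHahnBanachSmooth 𝕜 Y) {y : Y}
    (hy : IsSmoothPoint 𝕜 y) : IsVerySmoothPoint 𝕜 y := by
  refine ⟨hy, ?_⟩
  obtain ⟨hy1, φ, hφ⟩ := hy
  have hφm : φ ∈ stateSpace 𝕜 y := hφ ▸ rfl
  have hiso : ‖NormedSpace.inclusionInDoubleDual 𝕜 Y y‖ = 1 :=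
    ((NormedSpace.inclusionInDoubleDualLi 𝕜).norm_map y).trans hy1
  refine ⟨hiso, NormedSpace.inclusionInDoubleDual 𝕜 (StrongDual 𝕜 Y) φ, ?_⟩
  ext Λ
  rw [Set.mem_singleton_iff]
  constructor
  · rintro ⟨hΛ1, hΛ⟩
    have hres : Λ.comp (NormedSpace.inclusionInDoubleDual 𝕜 Y) = φ := by
      have : Λ.comp (NormedSpace.inclusionInDoubleDual 𝕜 Y) ∈ stateSpace 𝕜 y := by
        refine mem_stateSpace_of_one_le_re hy1 ?_ ?_
        · refine (Λ.opNorm_comp_le _).trans ?_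
          rw [hΛ1, one_mul]
          exact NormedSpace.inclusionInDoubleDual_norm_le 𝕜 Y
        · simp [hΛ]
      rwa [hφ] at this
    refine sub_eq_zero.1 (hY φ _ (fun z => ?_) hφm.1 ?_)
    · have := congrArg (fun χ : StrongDual 𝕜 Y => χ z) hres
      exact sub_eq_zero.2 this
    · rw [add_sub_cancel]
      exact hΛ1
  · rintro rfl
    exact ⟨((NormedSpace.inclusionInDoubleDualLi 𝕜).norm_map φ).trans hφm.1, hφm.2⟩

end SmoothPoints

/-- If a sequence in a weakly compact set of functionals converges pointwise, its limit is in the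
norm closure of the convex hull of the sequence. -/
theorem IsWeaklyCompact.mem_closure_convexHull_range {𝕜 : Type*} [RCLike 𝕜] {Y : Type*}
    [NormedAddCommGroup Y] [NormedSpace 𝕜 Y] {K : Set (StrongDual 𝕜 Y)}
    (hK : IsWeaklyCompact 𝕜 K) {φ : ℕ → StrongDual 𝕜 Y} (hφ : ∀ n, φ n ∈ K) {θ : StrongDual 𝕜 Y}
    (hθ : ∀ y, Tendsto (fun n => φ n y) atTop (𝓝 (θ y))) :
    θ ∈ closure (convexHull ℝ (Set.range φ)) := by
  obtain ⟨_, ⟨κ, -, rfl⟩, hlim⟩ := hK.ultrafilter_le_nhds'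
    ((hyperfilter ℕ).map fun n => toWeakSpace 𝕜 (StrongDual 𝕜 Y) (φ n))
    (Ultrafilter.mem_map.2 (Filter.univ_mem' fun n => ⟨φ n, hφ n, rfl⟩))
  have hlim' : Tendsto (fun n => toWeakSpace 𝕜 (StrongDual 𝕜 Y) (φ n)) (hyperfilter ℕ)
      (𝓝 (toWeakSpace 𝕜 (StrongDual 𝕜 Y) κ)) := hlim
  have hκ : κ = θ := by
    ext y
    have h1 : Tendsto (fun n => φ n y) (hyperfilter ℕ) (𝓝 (κ y)) :=
      ((WeakBilin.eval_continuous (topDualPairing 𝕜 (StrongDual 𝕜 Y)).flip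
        (NormedSpace.inclusionInDoubleDual 𝕜 Y y)).tendsto _).comp hlim'
    exact tendsto_nhds_unique h1 ((hθ y).mono_left Nat.hyperfilter_le_atTop)
  subst hκ
  have hmem : toWeakSpace 𝕜 (StrongDual 𝕜 Y) κ ∈
      closure (toWeakSpace 𝕜 (StrongDual 𝕜 Y) '' convexHull ℝ (Set.range φ)) :=
    mem_closure_of_tendsto hlim' (Filter.Eventually.of_forall fun n =>
      Set.mem_image_of_mem _ (subset_convexHull ℝ _ ⟨n, rfl⟩))
  -- Mazur: for convex sets the weak and norm closures coincide.
  rw [← (convex_convexHull ℝ (Set.range φ)).toWeakSpace_closure 𝕜] at hmem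
  exact ((toWeakSpace 𝕜 (StrongDual 𝕜 Y)).injective.mem_set_image).1 hmem

/-! ### Small sets in non-atomic probability spaces -/

section Nonatomic

variable {Ω : Type*} [MeasurableSpace Ω] {μ : Measure Ω} [IsProbabilityMeasure μ]

theorem IsNonatomicMeasure.exists_subset_measure_le (hμ : IsNonatomicMeasure μ) {A : Set Ω}
    (hA : MeasurableSet A) (hA0 : 0 < μ A) {ε : ENNReal} (hε : 0 < ε) :
    ∃ B ⊆ A, MeasurableSet B ∧ 0 < μ B ∧ μ B ≤ ε := by
  have key (n : ℕ) : ∃ B ⊆ A, MeasurableSet B ∧ 0 < μ B ∧ μ B ≤ 2⁻¹ ^ n := by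
    induction n with
    | zero => exact ⟨A, subset_rfl, hA, hA0, by simpa using prob_le_one⟩
    | succ n ih =>
      obtain ⟨B, hBA, hB, hB0, hBn⟩ := ih
      obtain ⟨C, hCB, hC, hC0, hClt⟩ := hμ B hB hB0
      have hsum : μ C + μ (B \ C) = μ B := by
        rw [← measure_union Set.disjoint_sdiff_right (hB.diff hC), Set.union_sdiff_cancel hCB]
      have hhalf {r : ENNReal} (hr : r + r ≤ μ B) : r ≤ 2⁻¹ ^ (n + 1) := by
        rw [pow_succ, ← div_eq_mul_inv, ENNReal.le_div_iff_mul_le (by simp) (by simp), mul_two]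
        exact hr.trans hBn
      rcases le_total (μ C) (μ (B \ C)) with hle | hle
      · exact ⟨C, hCB.trans hBA, hC, hC0, hhalf (hsum ▸ add_le_add_right hle _)⟩
      · refine ⟨B \ C, Set.sdiff_subset.trans hBA, hB.diff hC, ?_,
          hhalf (hsum ▸ add_le_add_left hle _)⟩
        refine pos_iff_ne_zero.2 fun h0 => hClt.ne ?_
        rw [← hsum, h0, add_zero]
  obtain ⟨n, hn⟩ := ENNReal.exists_inv_two_pow_lt hε.ne'
  obtain ⟨B, h1, h2, h3, h4⟩ := key n
  exact ⟨B, h1, h2, h3, h4.trans hn.le⟩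

/-- A property of measurable sets that is stable under unions and holds for sets of small measure
holds for the whole space when the measure is non-atomic. -/
theorem IsNonatomicMeasure.induction_small (hμ : IsNonatomicMeasure μ) {ε : ENNReal} (hε : 0 < ε)
    {P : Set Ω → Prop} (hsmall : ∀ A, MeasurableSet A → μ A ≤ ε → P A)
    (hunion : ∀ A B, MeasurableSet A → MeasurableSet B → P A → P B → P (A ∪ B)) :
    P Set.univ := by
  -- Exhaustion: unions of sets nearly attaining the supremal measure leave a null set, since
  -- otherwise a small piece of the remainder could be added.
  let S : Set ENNReal := {r | ∃ G, MeasurableSet G ∧ P G ∧ μ G = r}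
  have hS : S.Nonempty := ⟨_, ∅, MeasurableSet.empty, hsmall ∅ .empty (by simp), rfl⟩
  obtain ⟨u, -, hu, huS⟩ := exists_seq_tendsto_sSup hS (OrderTop.bddAbove S)
  choose G hG hPG hGu using huS
  have hH (n : ℕ) : MeasurableSet (Set.accumulate G n) ∧ P (Set.accumulate G n) := by
    induction n with
    | zero => simpa [Set.accumulate] using ⟨hG 0, hPG 0⟩
    | succ n ih =>
      rw [Set.accumulate_succ]
      exact ⟨ih.1.union (hG _), hunion _ _ ih.1 (hG _) ih.2 (hPG _)⟩
  have hlim : Tendsto (fun n => μ (Set.accumulate G n)) atTop (𝓝 (sSup S)) :=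
    tendsto_of_tendsto_of_tendsto_of_le_of_le hu tendsto_const_nhds
      (fun n => hGu n ▸ measure_mono (Set.subset_accumulate))
      (fun n => le_sSup ⟨_, (hH n).1, (hH n).2, rfl⟩)
  have hUm : MeasurableSet (⋃ n, Set.accumulate G n) := .iUnion fun n => (hH n).1
  have hnull : μ (⋃ n, Set.accumulate G n)ᶜ = 0 := by
    by_contra hne
    obtain ⟨B, hB, hBm, hB0, hBε⟩ :=
      hμ.exists_subset_measure_le hUm.compl (pos_iff_ne_zero.2 hne) hε
    have hle (n : ℕ) : μ (Set.accumulate G n) + μ B ≤ sSup S := by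
      have hd : Disjoint (Set.accumulate G n) B :=
        Set.disjoint_left.2 fun x hx hxB => hB hxB (Set.mem_iUnion.2 ⟨n, hx⟩)
      rw [← measure_union hd hBm]
      exact le_sSup ⟨_, (hH n).1.union hBm,
        hunion _ _ (hH n).1 hBm (hH n).2 (hsmall B hBm hBε), rfl⟩
    have h1 : sSup S + μ B ≤ sSup S := le_of_tendsto' (hlim.add_const _) hle
    have h2 : sSup S ≠ ⊤ := by
      refine ((sSup_le ?_).trans_lt ENNReal.one_lt_top).ne
      rintro _ ⟨A, -, -, rfl⟩
      exact prob_le_one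
    exact (ENNReal.lt_add_right h2 hB0.ne').not_ge h1
  have htend : Tendsto (fun n => μ (Set.accumulate G n)ᶜ) atTop (𝓝 0) := by
    have h1 := tendsto_measure_iInter_atTop (μ := μ) (s := fun n => (Set.accumulate G n)ᶜ)
      (fun n => (hH n).1.compl.nullMeasurableSet)
      (fun m n h => Set.compl_subset_compl.2 (Set.monotone_accumulate h)) ⟨0, measure_ne_top _ _⟩
    rwa [← Set.compl_iUnion, hnull] at h1
  obtain ⟨n, hn⟩ := (htend.eventually_le_const hε).exists
  rw [← Set.union_compl_self (Set.accumulate G n)]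
  exact hunion _ _ (hH n).1 (hH n).1.compl (hH n).2 (hsmall _ (hH n).1.compl hn)

end Nonatomic

/-! ### Restriction in `L¹` and uniqueness of the state -/

section Restriction

variable (𝕜 : Type*) [RCLike 𝕜] {X : Type*} [NormedAddCommGroup X] [NormedSpace 𝕜 X]
  {Ω : Type*} [MeasurableSpace Ω] {μ : Measure Ω}

/-- Multiplication by the indicator function of a measurable set, on `L¹`. -/
noncomputable def indicatorL1 {s : Set Ω} (hs : MeasurableSet s) : Lp X 1 μ →L[𝕜] Lp X 1 μ :=
  LinearMap.mkContinuous
    { toFun := fun g => ((Lp.memLp g).indicator hs).toLp _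
      map_add' := fun g h => by
        ext1
        filter_upwards [((Lp.memLp (g + h)).indicator hs).coeFn_toLp,
          ((Lp.memLp g).indicator hs).coeFn_toLp, ((Lp.memLp h).indicator hs).coeFn_toLp,
          Lp.coeFn_add g h, Lp.coeFn_add (((Lp.memLp g).indicator hs).toLp _)
            (((Lp.memLp h).indicator hs).toLp _)] with ω h1 h2 h3 h4 h5
        rw [h1, h5, Pi.add_apply, h2, h3]
        by_cases hω : ω ∈ s
        · rw [Set.indicator_of_mem hω, Set.indicator_of_mem hω, Set.indicator_of_mem hω, h4,
            Pi.add_apply]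
        · simp [hω]
      map_smul' := fun c g => by
        ext1
        filter_upwards [((Lp.memLp (c • g)).indicator hs).coeFn_toLp,
          ((Lp.memLp g).indicator hs).coeFn_toLp, Lp.coeFn_smul c g,
          Lp.coeFn_smul c (((Lp.memLp g).indicator hs).toLp _)] with ω h1 h2 h3 h4
        rw [h1, RingHom.id_apply, h4, Pi.smul_apply, h2]
        by_cases hω : ω ∈ s
        · rw [Set.indicator_of_mem hω, Set.indicator_of_mem hω, h3, Pi.smul_apply]
        · simp [hω] } 1 fun g => by
    rw [one_mul]
    refine Lp.norm_le_norm_of_ae_le ?_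
    filter_upwards [((Lp.memLp g).indicator hs).coeFn_toLp] with ω hω
    simp only [LinearMap.coe_mk, AddHom.coe_mk, hω]
    exact norm_indicator_le_norm_self _ _

variable {𝕜}

theorem coeFn_indicatorL1 {s : Set Ω} (hs : MeasurableSet s) (g : Lp X 1 μ) :
    indicatorL1 𝕜 hs g =ᵐ[μ] s.indicator g :=
  ((Lp.memLp g).indicator hs).coeFn_toLp

theorem norm_indicatorL1 {s : Set Ω} (hs : MeasurableSet s) (g : Lp X 1 μ) :
    ‖indicatorL1 𝕜 hs g‖ = ∫ ω in s, ‖g ω‖ ∂μ := by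
  rw [L1.norm_eq_integral_norm, ← integral_indicator hs]
  refine integral_congr_ae ?_
  filter_upwards [coeFn_indicatorL1 (𝕜 := 𝕜) hs g] with ω hω
  rw [hω, norm_indicator_eq_indicator_norm]

theorem indicatorL1_union {s t : Set Ω} (hs : MeasurableSet s) (ht : MeasurableSet t)
    (hst : Disjoint s t) (g : Lp X 1 μ) :
    indicatorL1 𝕜 (hs.union ht) g = indicatorL1 𝕜 hs g + indicatorL1 𝕜 ht g := by
  ext1
  filter_upwards [coeFn_indicatorL1 (𝕜 := 𝕜) hs g, coeFn_indicatorL1 (𝕜 := 𝕜) ht g,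
    coeFn_indicatorL1 (𝕜 := 𝕜) (hs.union ht) g,
    Lp.coeFn_add (indicatorL1 𝕜 hs g) (indicatorL1 𝕜 ht g)] with ω h1 h2 h3 h4
  rw [h3, h4, Pi.add_apply, h1, h2, Set.indicator_union_of_disjoint hst]

theorem indicatorL1_add_compl {s : Set Ω} (hs : MeasurableSet s) (g : Lp X 1 μ) :
    indicatorL1 𝕜 hs g + indicatorL1 𝕜 hs.compl g = g := by
  ext1
  filter_upwards [coeFn_indicatorL1 (𝕜 := 𝕜) hs g, coeFn_indicatorL1 (𝕜 := 𝕜) hs.compl g,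
    Lp.coeFn_add (indicatorL1 𝕜 hs g) (indicatorL1 𝕜 hs.compl g)] with ω h1 h2 h4
  rw [h4, Pi.add_apply, h1, h2, Set.indicator_self_add_compl_apply]

theorem norm_indicatorL1_add_compl {s : Set Ω} (hs : MeasurableSet s) (g : Lp X 1 μ) :
    ‖indicatorL1 𝕜 hs g‖ + ‖indicatorL1 𝕜 hs.compl g‖ = ‖g‖ := by
  rw [norm_indicatorL1, norm_indicatorL1, L1.norm_eq_integral_norm]
  exact integral_add_compl hs (L1.integrable_coeFn g).norm

theorem indicatorL1_comp_of_subset {s t : Set Ω} (hs : MeasurableSet s) (ht : MeasurableSet t)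
    (hts : t ⊆ s) (g : Lp X 1 μ) :
    indicatorL1 𝕜 hs (indicatorL1 𝕜 ht g) = indicatorL1 𝕜 ht g := by
  ext1
  filter_upwards [coeFn_indicatorL1 (𝕜 := 𝕜) ht g,
    coeFn_indicatorL1 (𝕜 := 𝕜) hs (indicatorL1 𝕜 ht g)] with ω h1 h2
  rw [h2]
  by_cases hω : ω ∈ s
  · simp [hω]
  · have : ω ∉ t := fun h => hω (hts h)
    simp [hω, h1, this]

theorem tendsto_indicatorL1_zero {s : ℕ → Set Ω} (hs : ∀ n, MeasurableSet (s n))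
    (hlim : Tendsto (fun n => μ (s n)) atTop (𝓝 0)) (g : Lp X 1 μ) :
    Tendsto (fun n => indicatorL1 𝕜 (hs n) g) atTop (𝓝 0) := by
  rw [tendsto_zero_iff_norm_tendsto_zero]
  simp_rw [norm_indicatorL1]
  exact (L1.integrable_coeFn g).norm.tendsto_setIntegral_nhds_zero hlim

/-- Two states can be glued along a measurable set. -/
theorem add_comp_indicatorL1_mem_stateSpace {f : Lp X 1 μ} (hf : ‖f‖ = 1)
    {φ θ : StrongDual 𝕜 (Lp X 1 μ)} (hφ : φ ∈ stateSpace 𝕜 f) (hθ : θ ∈ stateSpace 𝕜 f)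
    {s : Set Ω} (hs : MeasurableSet s) :
    θ + (φ - θ).comp (indicatorL1 𝕜 hs) ∈ stateSpace 𝕜 f := by
  have happ (g : Lp X 1 μ) : (θ + (φ - θ).comp (indicatorL1 𝕜 hs)) g
      = φ (indicatorL1 𝕜 hs g) + θ (indicatorL1 𝕜 hs.compl g) := by
    have := congrArg θ (indicatorL1_add_compl (𝕜 := 𝕜) hs g)
    rw [map_add] at this
    simp only [add_apply, ContinuousLinearMap.comp_apply,
      sub_apply]
    rw [← this]
    ring
  have hb {χ : StrongDual 𝕜 (Lp X 1 μ)} (hχ : χ ∈ stateSpace 𝕜 f) (g : Lp X 1 μ) :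
      ‖χ g‖ ≤ ‖g‖ := by simpa [hχ.1] using χ.le_opNorm g
  have hsum (χ : StrongDual 𝕜 (Lp X 1 μ)) (hχ : χ ∈ stateSpace 𝕜 f) :
      RCLike.re (χ (indicatorL1 𝕜 hs f)) + RCLike.re (χ (indicatorL1 𝕜 hs.compl f)) = 1 := by
    rw [← map_add, ← map_add, indicatorL1_add_compl, hχ.2, RCLike.one_re]
  refine mem_stateSpace_of_one_le_re hf ?_ ?_
  · refine ContinuousLinearMap.opNorm_le_bound _ zero_le_one fun g => ?_
    rw [happ, one_mul, ← norm_indicatorL1_add_compl (𝕜 := 𝕜) hs g]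
    exact (norm_add_le _ _).trans (add_le_add (hb hφ _) (hb hθ _))
  · rw [happ, map_add]
    have h1 := hsum φ hφ
    have h2 := hsum θ hθ
    have h3 := (RCLike.re_le_norm _).trans (hb hφ (indicatorL1 𝕜 hs.compl f))
    have h4 := (RCLike.re_le_norm _).trans (hb hθ (indicatorL1 𝕜 hs f))
    have h5 := norm_indicatorL1_add_compl (𝕜 := 𝕜) hs f
    linarith

variable [IsProbabilityMeasure μ]

/-- The `L¹` norm is additive over disjoint pieces, so the reverse inequality on all small subsets
would add up to all of `s`. -/
theorem IsNonatomicMeasure.exists_small_subset_lt_norm_apply (hμ : IsNonatomicMeasure μ)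
    (ψ : StrongDual 𝕜 (Lp X 1 μ)) (g : Lp X 1 μ) {δ : ℝ} {s : Set Ω} (hs : MeasurableSet s)
    (h : δ * ‖indicatorL1 𝕜 hs g‖ < ‖ψ (indicatorL1 𝕜 hs g)‖) {ε : ENNReal} (hε : 0 < ε) :
    ∃ t ⊆ s, ∃ ht : MeasurableSet t, μ t ≤ ε ∧
      δ * ‖indicatorL1 𝕜 ht g‖ < ‖ψ (indicatorL1 𝕜 ht g)‖ := by
  by_contra! hcon
  have key := hμ.induction_small hε (P := fun A => ∀ t ⊆ s, t ⊆ A → ∀ ht : MeasurableSet t,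
    ‖ψ (indicatorL1 𝕜 ht g)‖ ≤ δ * ‖indicatorL1 𝕜 ht g‖)
    (fun A _ hAε t hts htA ht => hcon t hts ht ((measure_mono htA).trans hAε))
    (fun A B hA hB hPA hPB t hts htAB ht => ?_)
  · exact (key s subset_rfl (Set.subset_univ s) hs).not_gt h
  · have h1 := hPA (t ∩ A) (Set.inter_subset_left.trans hts) Set.inter_subset_right (ht.inter hA)
    have h2 := hPB (t \ A) (Set.sdiff_subset.trans hts)
      (fun x hx => (htAB hx.1).resolve_left hx.2) (ht.diff hA)
    have hd : Disjoint (t ∩ A) (t \ A) := Set.disjoint_sdiff_inter.symm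
    have hsplit : indicatorL1 𝕜 ht g =
        indicatorL1 𝕜 (ht.inter hA) g + indicatorL1 𝕜 (ht.diff hA) g := by
      rw [← indicatorL1_union _ _ hd]
      congr 2
      exact (Set.inter_union_sdiff t A).symm
    have hnorm : ‖indicatorL1 𝕜 ht g‖ =
        ‖indicatorL1 𝕜 (ht.inter hA) g‖ + ‖indicatorL1 𝕜 (ht.diff hA) g‖ := by
      rw [norm_indicatorL1, norm_indicatorL1, norm_indicatorL1]
      exact (integral_inter_add_sdiff hA (L1.integrable_coeFn g).norm.integrableOn).symm
    rw [hnorm, hsplit, map_add, mul_add]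
    exact (norm_add_le _ _).trans (add_le_add h1 h2)

theorem stateSpace_subsingleton_of_isWeaklyCompact (hμ : IsNonatomicMeasure μ) {f : Lp X 1 μ}
    (hf : ‖f‖ = 1) (hK : IsWeaklyCompact 𝕜 (stateSpace 𝕜 f)) :
    (stateSpace 𝕜 f).Subsingleton := by
  intro φ hφ θ hθ
  by_contra hne
  obtain ⟨g, hg⟩ : ∃ g, (φ - θ) g ≠ 0 := by
    by_contra! h
    exact hne (sub_eq_zero.1 (ContinuousLinearMap.ext h))
  have hg0 : 0 < ‖g‖ := norm_pos_iff.2 fun h => hg (by rw [h, map_zero])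
  obtain ⟨δ, hδ0, hδ⟩ : ∃ δ : ℝ, 0 < δ ∧ δ * ‖g‖ < ‖(φ - θ) g‖ := by
    refine ⟨‖(φ - θ) g‖ / (2 * ‖g‖), by positivity, ?_⟩
    have : 0 < ‖(φ - θ) g‖ := norm_pos_iff.2 hg
    field_simp
    linarith
  let T := {s : Set Ω // ∃ hs : MeasurableSet s,
    δ * ‖indicatorL1 𝕜 hs g‖ < ‖(φ - θ) (indicatorL1 𝕜 hs g)‖}
  have huniv : indicatorL1 𝕜 MeasurableSet.univ g = g := by
    ext1
    simpa using coeFn_indicatorL1 (𝕜 := 𝕜) MeasurableSet.univ g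
  have hstep (s : T) (n : ℕ) : ∃ t : T, t.1 ⊆ s.1 ∧ μ t.1 ≤ 2⁻¹ ^ n := by
    obtain ⟨s, hs, hlt⟩ := s
    obtain ⟨t, hts, ht, htn, hlt'⟩ := hμ.exists_small_subset_lt_norm_apply (φ - θ) g hs hlt
      (ε := 2⁻¹ ^ n) (ENNReal.pow_pos (by simp) n)
    exact ⟨⟨t, ht, hlt'⟩, hts, htn⟩
  choose next hnext_sub hnext_le using hstep
  let C : ℕ → T := fun n =>
    Nat.rec ⟨Set.univ, MeasurableSet.univ, by rwa [huniv]⟩ (fun n s => next s n) n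
  have hanti : Antitone fun n => (C n).1 := antitone_nat_of_succ_le fun n => hnext_sub (C n) n
  have hlim : Tendsto (fun n => μ (C n).1) atTop (𝓝 0) := by
    rw [← tendsto_add_atTop_iff_nat 1]
    exact tendsto_of_tendsto_of_tendsto_of_le_of_le tendsto_const_nhds
      (ENNReal.tendsto_pow_atTop_nhds_zero_of_lt_one (by simp))
      (fun n => zero_le) (fun n => hnext_le (C n) n)
  have hC (n : ℕ) : MeasurableSet (C n).1 := (C n).2.1
  have hlt (n : ℕ) : δ * ‖indicatorL1 𝕜 (hC n) g‖ < ‖(φ - θ) (indicatorL1 𝕜 (hC n) g)‖ :=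
    (C n).2.2
  have hmem : θ ∈ closure (convexHull ℝ
      (Set.range fun n => θ + (φ - θ).comp (indicatorL1 𝕜 (hC n)))) := by
    refine hK.mem_closure_convexHull_range
      (fun n => add_comp_indicatorL1_mem_stateSpace hf hφ hθ (hC n)) fun h => ?_
    have h1 := (((φ - θ).continuous.tendsto 0).comp
      (tendsto_indicatorL1_zero (𝕜 := 𝕜) hC hlim h)).const_add (θ h)
    rwa [map_zero, add_zero] at h1
  obtain ⟨χ, hχ, hdist⟩ := Metric.mem_closure_iff.1 hmem δ hδ0
  -- "Eventually" matters: each glued state agrees with `φ` on `C m` from its own index on, and this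
  -- survives finite convex combinations.
  have hconv : Convex ℝ {χ : StrongDual 𝕜 (Lp X 1 μ) | ∀ᶠ m in atTop,
      (χ - θ) (indicatorL1 𝕜 (hC m) g) = (φ - θ) (indicatorL1 𝕜 (hC m) g)} := by
    intro χ₁ h₁ χ₂ h₂ a b _ _ hab
    filter_upwards [h₁, h₂] with m hm₁ hm₂
    have : a • χ₁ + b • χ₂ - θ = a • (χ₁ - θ) + b • (χ₂ - θ) := by
      rw [smul_sub, smul_sub, sub_add_sub_comm, ← add_smul, hab, one_smul]
    rw [this, add_apply, smul_apply,
      smul_apply, hm₁, hm₂, ← add_smul, hab, one_smul]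
  have hrange : (Set.range fun n => θ + (φ - θ).comp (indicatorL1 𝕜 (hC n))) ⊆
      {χ : StrongDual 𝕜 (Lp X 1 μ) | ∀ᶠ m in atTop,
        (χ - θ) (indicatorL1 𝕜 (hC m) g) = (φ - θ) (indicatorL1 𝕜 (hC m) g)} := by
    rintro _ ⟨n, rfl⟩
    filter_upwards [eventually_ge_atTop n] with m hm
    rw [add_sub_cancel_left, ContinuousLinearMap.comp_apply,
      indicatorL1_comp_of_subset (hC n) (hC m) (hanti hm)]
  obtain ⟨m, hm⟩ := (convexHull_min hrange hconv hχ).exists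
  have h1 := hlt m
  rw [← hm] at h1
  have h2 := (χ - θ).le_opNorm (indicatorL1 𝕜 (hC m) g)
  rw [dist_comm, dist_eq_norm] at hdist
  exact (h2.trans (mul_le_mul_of_nonneg_right hdist.le (norm_nonneg _))).not_gt h1

end Restriction

/-! ### From smoothness in `L¹` to smoothness of the values -/

section PointwiseSmoothness

variable {𝕜 : Type*} [RCLike 𝕜] {X : Type*} [NormedAddCommGroup X] [NormedSpace 𝕜 X]
  {Ω : Type*} [MeasurableSpace Ω] {μ : Measure Ω} [IsProbabilityMeasure μ]

theorem IsSmoothPoint.ae_exists_second_difference_lt {f : Lp X 1 μ} (hf : IsSmoothPoint 𝕜 f)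
    (y : X) : ∀ᵐ ω ∂μ, ∀ c : ℝ, 0 < c → ∃ n : ℕ,
      (n + 1) * (‖f ω + (((n + 1 : ℝ)⁻¹ : ℝ) : 𝕜) • y‖
        + ‖f ω - (((n + 1 : ℝ)⁻¹ : ℝ) : 𝕜) • y‖ - 2 * ‖f ω‖) < c := by
  let h : Lp X 1 μ := Lp.const 1 μ y
  let a : ℕ → Ω → ℝ := fun n ω => (n + 1) * (‖f ω + (((n + 1 : ℝ)⁻¹ : ℝ) : 𝕜) • y‖
    + ‖f ω - (((n + 1 : ℝ)⁻¹ : ℝ) : 𝕜) • y‖ - 2 * ‖f ω‖)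
  have hfi : Integrable f μ := L1.integrable_coeFn f
  have hplus (n : ℕ) : Integrable (fun ω => ‖f ω + (((n + 1 : ℝ)⁻¹ : ℝ) : 𝕜) • y‖) μ :=
    (hfi.add (integrable_const _)).norm
  have hminus (n : ℕ) : Integrable (fun ω => ‖f ω - (((n + 1 : ℝ)⁻¹ : ℝ) : 𝕜) • y‖) μ :=
    (hfi.sub (integrable_const _)).norm
  have ha (n : ℕ) : Integrable (a n) μ :=
    (((hplus n).add (hminus n)).sub (hfi.norm.const_mul 2)).const_mul _
  have ha0 (n : ℕ) (ω : Ω) : 0 ≤ a n ω := by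
    refine mul_nonneg (by positivity) ?_
    have h1 := norm_add_le (f ω + (((n + 1 : ℝ)⁻¹ : ℝ) : 𝕜) • y)
      (f ω - (((n + 1 : ℝ)⁻¹ : ℝ) : 𝕜) • y)
    rw [add_add_sub_cancel, ← two_smul ℕ, RCLike.norm_nsmul 𝕜] at h1
    simp only [nsmul_eq_mul, Nat.cast_ofNat] at h1
    linarith
  have hint (n : ℕ) : ∫ ω, a n ω ∂μ = (n + 1) * (‖f + (((n + 1 : ℝ)⁻¹ : ℝ) : 𝕜) • h‖
      + ‖f - (((n + 1 : ℝ)⁻¹ : ℝ) : 𝕜) • h‖ - 2 * ‖f‖) := by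
    rw [L1.norm_eq_integral_norm, L1.norm_eq_integral_norm, L1.norm_eq_integral_norm]
    have hh := Lp.coeFn_const (p := 1) (μ := μ) (c := y)
    have e1 : ∫ ω, ‖(f + (((n + 1 : ℝ)⁻¹ : ℝ) : 𝕜) • h : Lp X 1 μ) ω‖ ∂μ
        = ∫ ω, ‖f ω + (((n + 1 : ℝ)⁻¹ : ℝ) : 𝕜) • y‖ ∂μ := by
      refine integral_congr_ae ?_
      filter_upwards [hh, Lp.coeFn_add f ((((n + 1 : ℝ)⁻¹ : ℝ) : 𝕜) • h),
        Lp.coeFn_smul (((n + 1 : ℝ)⁻¹ : ℝ) : 𝕜) h] with ω h1 h2 h3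
      rw [h2, Pi.add_apply, h3, Pi.smul_apply, h1, Function.const_apply]
    have e2 : ∫ ω, ‖(f - (((n + 1 : ℝ)⁻¹ : ℝ) : 𝕜) • h : Lp X 1 μ) ω‖ ∂μ
        = ∫ ω, ‖f ω - (((n + 1 : ℝ)⁻¹ : ℝ) : 𝕜) • y‖ ∂μ := by
      refine integral_congr_ae ?_
      filter_upwards [hh, Lp.coeFn_sub f ((((n + 1 : ℝ)⁻¹ : ℝ) : 𝕜) • h),
        Lp.coeFn_smul (((n + 1 : ℝ)⁻¹ : ℝ) : 𝕜) h] with ω h1 h2 h3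
      rw [h2, Pi.sub_apply, h3, Pi.smul_apply, h1, Function.const_apply]
    have e3 := integral_sub ((hplus n).add (hminus n)) (hfi.norm.const_mul 2)
    simp only [Pi.add_apply] at e3
    rw [e1, e2, integral_const_mul, e3, integral_add (hplus n) (hminus n), integral_const_mul]
  -- Taking the infimum over `n` avoids any need for pointwise convergence of the quotients.
  have hzero : ∫⁻ ω, ⨅ n, ENNReal.ofReal (a n ω) ∂μ = 0 := by
    refine le_antisymm (ENNReal.le_of_forall_pos_le_add fun c hc _ => ?_) zero_le
    obtain ⟨n, hn⟩ := hf.exists_second_difference_lt h (NNReal.coe_pos.2 hc)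
    rw [← hint] at hn
    calc ∫⁻ ω, ⨅ n, ENNReal.ofReal (a n ω) ∂μ ≤ ∫⁻ ω, ENNReal.ofReal (a n ω) ∂μ :=
          lintegral_mono fun ω => iInf_le _ n
      _ = ENNReal.ofReal (∫ ω, a n ω ∂μ) :=
          (ofReal_integral_eq_lintegral_ofReal (ha n) (.of_forall (ha0 n))).symm
      _ ≤ ENNReal.ofReal c := ENNReal.ofReal_le_ofReal hn.le
      _ = 0 + c := by rw [zero_add, ENNReal.ofReal_coe_nnreal]
  have hmeas : AEMeasurable (fun ω => ⨅ n, ENNReal.ofReal (a n ω)) μ :=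
    AEMeasurable.iInf fun n => (ha n).aemeasurable.ennreal_ofReal
  filter_upwards [(lintegral_eq_zero_iff' hmeas).1 hzero] with ω hω c hc
  have hlt : ⨅ n, ENNReal.ofReal (a n ω) < ENNReal.ofReal c := by
    rw [show ⨅ n, ENNReal.ofReal (a n ω) = 0 from hω]
    exact ENNReal.ofReal_pos.2 hc
  obtain ⟨n, hn⟩ := iInf_lt_iff.1 hlt
  exact ⟨n, (ENNReal.ofReal_lt_ofReal_iff hc).1 hn⟩

theorem IsSmoothPoint.ae_isSmoothPoint [TopologicalSpace.SeparableSpace X] {f : Lp X 1 μ}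
    (hf : IsSmoothPoint 𝕜 f) : ∀ᵐ ω ∂μ, IsSmoothPoint 𝕜 (((‖f ω‖ : 𝕜)⁻¹) • f ω) := by
  obtain ⟨D, hDc, hD⟩ := TopologicalSpace.exists_countable_dense X
  obtain ⟨y, hy⟩ : ∃ y : X, y ≠ 0 := by
    by_contra! h
    have : f = 0 := by
      ext1
      exact .of_forall fun ω => (h _).trans (h _).symm
    simpa [this] using hf.1
  obtain ⟨ξ, hξ, hξy⟩ := exists_dual_vector 𝕜 y (norm_ne_zero_iff.2 hy)
  filter_upwards [(ae_ball_iff hDc).2 fun y _ => hf.ae_exists_second_difference_lt y] with ω hω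
  -- At the zero vector both `0` and `ξ` would be norming, against uniqueness.
  have hne : f ω ≠ 0 := by
    intro h0
    have : ξ = 0 := eq_of_second_difference hD hω hξ.le (by simp) (by simp [h0]) (by simp [h0])
    simp [this] at hξ
  have hne' : (‖f ω‖ : 𝕜) ≠ 0 := by simpa using hne
  have hstate {χ : StrongDual 𝕜 X} : χ ((‖f ω‖ : 𝕜)⁻¹ • f ω) = 1 ↔ χ (f ω) = (‖f ω‖ : 𝕜) := by
    rw [map_smul, smul_eq_mul, inv_mul_eq_one₀ hne', eq_comm]
  obtain ⟨φ, hφ, hφx⟩ := exists_dual_vector 𝕜 (f ω) (norm_ne_zero_iff.2 hne)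
  refine ⟨?_, φ, Set.eq_singleton_iff_unique_mem.2 ⟨⟨hφ, hstate.2 hφx⟩, fun χ hχ => ?_⟩⟩
  · rw [norm_smul, norm_inv, RCLike.norm_ofReal, abs_norm]
    exact inv_mul_cancel₀ (norm_ne_zero_iff.2 hne)
  · exact eq_of_second_difference hD hω hχ.1.le hφ.le (hstate.1 hχ.2) hφx

end PointwiseSmoothness

/-- Since `0⁻¹ = 0`, the unit norm required by `IsVerySmoothPoint` already encodes `f ω ≠ 0`. -/
theorem mainTheorem9 {𝕜 : Type*} [RCLike 𝕜]
    {X : Type*} [NormedAddCommGroup X] [NormedSpace 𝕜 X] [CompleteSpace X]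
    [TopologicalSpace.SeparableSpace X] (hX : IsHahnBanachSmooth 𝕜 X)
    {Ω : Type*} [MeasurableSpace Ω] (μ : Measure Ω) [IsProbabilityMeasure μ]
    (hμ : IsNonatomicMeasure μ)
    (f : Lp X 1 μ) (hf : ‖f‖ = 1)
    (hSf : IsWeaklyCompact 𝕜 (stateSpace 𝕜 f)) :
    ∀ᵐ ω ∂μ, IsVerySmoothPoint 𝕜 (((‖f ω‖ : 𝕜)⁻¹) • f ω) := by
  have hsmooth : IsSmoothPoint 𝕜 f := by
    obtain ⟨φ, hφ, hφf⟩ := exists_dual_vector 𝕜 f (by simp [hf])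
    have hmem : φ ∈ stateSpace 𝕜 f := ⟨hφ, by simp [hφf, hf]⟩
    exact ⟨hf, φ, (stateSpace_subsingleton_of_isWeaklyCompact hμ hf hSf).eq_singleton_of_mem hmem⟩
  exact hsmooth.ae_isSmoothPoint.mono fun ω hω => hX.isVerySmoothPoint hω
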